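/- Let $A$ be a normed $*$-algebra: a complex associative algebra, not necessarily unital, with an involution $*$ and a submultiplicative norm $|\cdot|$ (neither completeness of $A$ nor continuity of the involution is assumed). Let $A_{sa}$ be the set of Hermitian elements of $A$. For $a\in A$ put $r_\lambda(a)=\inf_{n\ge 1}|a^n|^{1/n}$ and $r_\sigma(a)=r_\lambda(a^*a)^{1/2}$. A linear functional $\varphi:A\to\mathbb C$ is *positive* if $\varphi(a^*a)\ge 0$ for all $a\in A$, and *Hermitian* if $\varphi(a^*)=\overline{\varphi(a)}$ for all $a\in A$. A positive linear functional $\varphi$ is *weakly continuous on $A_{sa}$* if for each $b\in A$ the functional $a\mapsto\varphi(b^*ab)$ is continuous on $A_{sa}$. It has *finite variation* if there is $v\ge 0$ with $|\varphi(a)|^2\le v\,\varphi(a^*a)$ for all $a\in A$, and then its *variation* $v(\varphi)$ is the infimum of all such $v$. A *state* is a positive linear functional $\psi$ that is weakly continuous on $A_{sa}$ and has finite variation $v(\psi)=1$; $S(A)$ denotes the convex set of states, and a *pure state* is an extreme point of $S(A)$. A positive linear functional $\varphi_1$ is *subordinate* to $\varphi_2$ if $\lambda\varphi_2-\varphi_1$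 is positive for some real $\lambda\ge 0$. A Hermitian positive linear functional $\varphi$ of finite variation is *indecomposable* if every Hermitian positive linear functional of finite variation that is subordinate to $\varphi$ is a multiple of $\varphi$. A *representation* of $A$ in a (complex) Hilbert space $H$ is a $*$-algebra homomorphism $\pi:A\to B(H)$. It is *$\sigma$-contractive* if $\|\pi(a)\|\le r_\sigma(a)$ for all $a\in A$. It is *irreducible* if it is non-zero and $\{0\}$ and $H$ are the only closed subspaces of $H$ that are invariant under all $\pi(a)$, $a\in A$. Representations $\pi_1,\pi_2$ in $H_1,H_2$ are *spatially equivalent* if there is a unitary operator $U:H_1\to H_2$ with $U\pi_1(a)=\pi_2(a)U$ for all $a\in A$. For a state $\psi$, the *GNS representation* $\pi_\psi$ acts in the Hilbert space $H_\psi$ that is the Hausdorff completion of $A$ with respect to the positive semidefinite form $\langle a,b\rangle_\psi=\psi(b^*a)$; the operator $\pi_\psi(a)$ is the continuous extension of the left translation $b\mapsto ab$ (which is bounded for this form). Then: 1. For every state $\psi$ on $A$, the following conditions are equivalent: (i) $\pi_\psi$ is irreducible; (ii) $\psi$ is indecomposable; (iii) $\psi$ is a pure state. 2. The pure states on $A$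 parametrise the irreducible $\sigma$-contractive representations of $A$ in Hilbert spaces up to spatial equivalence, in the following sense. If $\psi$ is a pure state on $A$, then $\pi_\psi$ is an irreducible $\sigma$-contractive representation of $A$. Conversely, if $\pi$ is an irreducible $\sigma$-contractive representation of $A$ in a Hilbert space, then there exists a pure state $\psi$ on $A$ such that $\pi$ is spatially equivalent to $\pi_\psi$. -/

import Mathlib

open scoped ComplexOrder

noncomputable section

namespace NormedStarAlg

/-! A *normed `*`-algebra* is a complex associative algebra, not necessarily unital, with an
involution and a submultiplicative norm. No completeness, and no continuity of the involution, is
assumed. -/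

section Functionals

variable {A : Type*} [NonUnitalNormedRing A] [NormedSpace ℂ A] [IsScalarTower ℂ A A]
  [SMulCommClass ℂ A A] [StarRing A] [StarModule ℂ A]

/-- `φ` is a positive linear functional: `φ (a* a) ≥ 0` for all `a` (in particular these values
are real). -/
def IsPositive (φ : A →ₗ[ℂ] ℂ) : Prop :=
  ∀ a : A, 0 ≤ φ (star a * a)

/-- `φ` is Hermitian: `φ (a*)` is the complex conjugate of `φ a`. -/
def IsHermitian (φ : A →ₗ[ℂ] ℂ) : Prop :=
  ∀ a : A, φ (star a) = star (φ a)

/-- Weak continuity on the set `A_sa` of Hermitian elements: for every `b`, the functional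
`a ↦ φ (b* a b)` is continuous on `A_sa`. -/
def IsWeaklyContinuousOnSA (φ : A →ₗ[ℂ] ℂ) : Prop :=
  ∀ b : A, ContinuousOn (fun a : A => φ (star b * a * b)) {a : A | IsSelfAdjoint a}

/-- The constants `v ≥ 0` with `|φ a|² ≤ v φ (a* a)` for all `a`. -/
def variationBounds (φ : A →ₗ[ℂ] ℂ) : Set ℝ :=
  {v : ℝ | 0 ≤ v ∧ ∀ a : A, ‖φ a‖ ^ 2 ≤ v * (φ (star a * a)).re}

/-- `φ` has finite variation. -/
def HasFiniteVariation (φ : A →ₗ[ℂ] ℂ) : Prop :=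
  (variationBounds φ).Nonempty

/-- The variation of `φ` (meaningful when `φ` has finite variation). -/
def variation (φ : A →ₗ[ℂ] ℂ) : ℝ :=
  sInf (variationBounds φ)

/-- States on a normed `*`-algebra: positive linear functionals, weakly continuous on `A_sa`, of
finite variation equal to `1`. -/
structure IsState (ψ : A →ₗ[ℂ] ℂ) : Prop where
  positive : IsPositive ψ
  weaklyContinuous : IsWeaklyContinuousOnSA ψ
  finiteVariation : HasFiniteVariation ψ
  variation_eq_one : variation ψ = 1

/-- The set `S(A)` of states. -/
def stateSet (A : Type*) [NonUnitalNormedRing A] [NormedSpace ℂ A] [IsScalarTower ℂ A A]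
    [SMulCommClass ℂ A A] [StarRing A] [StarModule ℂ A] : Set (A →ₗ[ℂ] ℂ) :=
  {ψ | IsState ψ}

/-- Pure states: the extreme points of `S(A)`. -/
def IsPureState (ψ : A →ₗ[ℂ] ℂ) : Prop :=
  ψ ∈ (stateSet A).extremePoints ℝ

theorem IsPureState.isState {ψ : A →ₗ[ℂ] ℂ} (h : IsPureState ψ) : IsState ψ := h.1

/-- `φ₁` is subordinate to `φ₂`: `r φ₂ - φ₁` is positive for some real `r ≥ 0`. -/
def IsSubordinate (φ₁ φ₂ : A →ₗ[ℂ] ℂ) : Prop :=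
  ∃ r : ℝ, 0 ≤ r ∧ IsPositive ((r : ℂ) • φ₂ - φ₁)

/-- A Hermitian positive linear functional `φ` of finite variation is indecomposable if every
Hermitian positive linear functional of finite variation that is subordinate to `φ` is a multiple
of `φ`. -/
structure IsIndecomposable (φ : A →ₗ[ℂ] ℂ) : Prop where
  positive : IsPositive φ
  hermitian : IsHermitian φ
  finiteVariation : HasFiniteVariation φ
  eq_smul : ∀ φ₁ : A →ₗ[ℂ] ℂ, IsPositive φ₁ → IsHermitian φ₁ → HasFiniteVariation φ₁ →
    IsSubordinate φ₁ φ → ∃ z : ℂ, φ₁ = z • φ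

end Functionals

section Ptak

variable {A : Type*} [NonUnitalNormedRing A]

/-- `powSucc a n` is the power `a ^ (n + 1)`; the algebra need not have a unit. -/
def powSucc (a : A) : ℕ → A
  | 0 => a
  | n + 1 => powSucc a n * a

/-- `r_λ(a) = inf_{n ≥ 1} ‖aⁿ‖^{1/n}`. -/
def rLambda (a : A) : ℝ :=
  ⨅ n : ℕ, ‖powSucc a n‖ ^ (1 / ((n : ℝ) + 1))

/-- The Pták function `r_σ(a) = r_λ(a* a)^{1/2}`. -/
def rSigma [StarRing A] (a : A) : ℝ :=
  Real.sqrt (rLambda (star a * a))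

end Ptak

section Representations

variable {A : Type*} [NonUnitalNormedRing A] [NormedSpace ℂ A] [StarRing A]
  {H : Type*} [NormedAddCommGroup H] [InnerProductSpace ℂ H] [CompleteSpace H]
  {K : Type*} [NormedAddCommGroup K] [InnerProductSpace ℂ K] [CompleteSpace K]

/-! A representation of `A` in a Hilbert space `H` is a `*`-homomorphism `A →⋆ₙₐ[ℂ] (H →L[ℂ] H)`. -/

/-- A representation is irreducible if it is non-zero and its only closed invariant subspaces are
`{0}` and `H`. -/
def IsIrreducible (π : A →⋆ₙₐ[ℂ] (H →L[ℂ] H)) : Prop :=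
  (∃ a : A, π a ≠ 0) ∧
    ∀ M : Submodule ℂ H, IsClosed (M : Set H) → (∀ a : A, ∀ x ∈ M, π a x ∈ M) →
      M = ⊥ ∨ M = ⊤

/-- `π` is σ-contractive: `‖π a‖ ≤ r_σ(a)` for all `a`. -/
def IsSigmaContractive (π : A →⋆ₙₐ[ℂ] (H →L[ℂ] H)) : Prop :=
  ∀ a : A, ‖π a‖ ≤ rSigma a

/-- Spatial equivalence: there is a unitary operator `U : H → K` with `U π₁(a) = π₂(a) U`. -/
def SpatiallyEquivalent (π₁ : A →⋆ₙₐ[ℂ] (H →L[ℂ] H)) (π₂ : A →⋆ₙₐ[ℂ] (K →L[ℂ] K)) : Prop :=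
  ∃ U : H ≃ₗᵢ[ℂ] K, ∀ (a : A) (x : H), U (π₁ a x) = π₂ a (U x)

end Representations

/-! ### The GNS construction -/

section GNS

variable {A : Type*} [NonUnitalNormedRing A] [NormedSpace ℂ A] [IsScalarTower ℂ A A]
  [SMulCommClass ℂ A A] [StarRing A] [StarModule ℂ A] {φ : A →ₗ[ℂ] ℂ}

/-- The form `(a, b) ↦ φ (a* b)` is Hermitian (by polarisation). -/
theorem IsPositive.form_symm (hφ : IsPositive φ) (a b : A) :
    star (φ (star b * a)) = φ (star a * b) := by
  have him : ∀ c : A, (φ (star c * c)).im = 0 := fun c =>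
    ((Complex.le_def.mp (hφ c)).2).symm
  have h1 := him (a + b)
  have h2 := him (a + Complex.I • b)
  have ha := him a
  have hb := him b
  simp only [star_add, star_smul, add_mul, mul_add, map_add, smul_mul_assoc, mul_smul_comm,
    map_smul, smul_eq_mul, Complex.add_im, Complex.mul_im, Complex.mul_re, Complex.star_def,
    Complex.conj_I, Complex.neg_re, Complex.neg_im, Complex.I_re, Complex.I_im] at h1 h2
  apply Complex.ext
  · simp only [Complex.star_def, Complex.conj_re]
    linarith
  · simp only [Complex.star_def, Complex.conj_im]
    linarith

/-- The algebra `A`, to be equipped with the semi-inner product of the positive functional `φ`. -/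
@[nolint unusedArguments]
def PreGNS (hφ : IsPositive φ) : Type _ := A

instance (hφ : IsPositive φ) : AddCommGroup (PreGNS hφ) := inferInstanceAs (AddCommGroup A)
instance (hφ : IsPositive φ) : Module ℂ (PreGNS hφ) := inferInstanceAs (Module ℂ A)

/-- The identity map from `A` to `PreGNS`. -/
def toPreGNS (hφ : IsPositive φ) : A ≃ₗ[ℂ] PreGNS hφ := LinearEquiv.refl ℂ A

/-- The semi-inner product `(a, b) ↦ φ (a* b)`, conjugate-linear in the first variable. -/
@[reducible]
def preGNSCore (hφ : IsPositive φ) : PreInnerProductSpace.Core ℂ (PreGNS hφ) where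
  inner a b := φ (star ((toPreGNS hφ).symm a) * (toPreGNS hφ).symm b)
  conj_inner_symm a b := hφ.form_symm _ _
  re_inner_nonneg a := (Complex.le_def.mp (hφ ((toPreGNS hφ).symm a))).1
  add_left a b c := by rw [map_add, star_add, add_mul, map_add]
  smul_left a b r := by simp [smul_mul_assoc]

instance (hφ : IsPositive φ) : SeminormedAddCommGroup (PreGNS hφ) :=
  InnerProductSpace.Core.toSeminormedAddCommGroup (c := preGNSCore hφ)
instance (hφ : IsPositive φ) : InnerProductSpace ℂ (PreGNS hφ) :=
  InnerProductSpace.ofCore (preGNSCore hφ)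

theorem preGNS_inner (hφ : IsPositive φ) (a b : A) :
    inner ℂ (toPreGNS hφ a) (toPreGNS hφ b) = φ (star a * b) := rfl

theorem preGNS_norm_sq (hφ : IsPositive φ) (a : A) :
    ‖toPreGNS hφ a‖ ^ 2 = (φ (star a * a)).re := by
  rw [← preGNS_inner hφ, ← RCLike.re_eq_complex_re, ← norm_sq_eq_re_inner]

/-- The Hilbert space `H_φ`: the Hausdorff completion of `A` for the semi-inner product of `φ`.
It is the completion of the quotient of `A` by the isotropic subspace. -/
abbrev GNSSpace (hφ : IsPositive φ) : Type _ := UniformSpace.Completion (PreGNS hφ)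

/-- Left translations are bounded for the semi-inner product of `φ`. -/
theorem preGNS_norm_mul_le (hφ : IsPositive φ) (hc : IsWeaklyContinuousOnSA φ) (a b : A) :
    ‖toPreGNS hφ (a * b)‖ ≤ Real.sqrt ‖star a * a‖ * ‖toPreGNS hφ b‖ := by
  set s : ℝ := (φ (star b * b)).re with hs
  have hs0 : 0 ≤ s := (Complex.le_def.mp (hφ b)).1
  let h : ℕ → A := fun n => Nat.rec (star a * a) (fun _ x => x * x) n
  have h_zero : h 0 = star a * a := rfl
  have h_succ : ∀ n, h (n + 1) = h n * h n := fun _ => rfl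
  have h_sa : ∀ n, star (h n) = h n := by
    intro n
    induction n with
    | zero => simp [h_zero]
    | succ n ih => rw [h_succ, star_mul, ih]
  have h_norm : ∀ n, ‖h n‖ ≤ ‖star a * a‖ ^ (2 ^ n) := by
    intro n
    induction n with
    | zero => simp [h_zero]
    | succ n ih =>
      calc ‖h (n + 1)‖ ≤ ‖h n‖ * ‖h n‖ := norm_mul_le _ _
        _ ≤ ‖star a * a‖ ^ (2 ^ n) * ‖star a * a‖ ^ (2 ^ n) := by gcongr
        _ = ‖star a * a‖ ^ (2 ^ (n + 1)) := by rw [← pow_add]; congr 1; ring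
  let q : ℕ → ℝ := fun n => (φ (star b * h n * b)).re
  have q_zero : q 0 = ‖toPreGNS hφ (a * b)‖ ^ 2 := by
    rw [preGNS_norm_sq]
    simp only [q, h_zero, star_mul, mul_assoc]
  have q_step : ∀ n, q n ^ 2 ≤ s * q (n + 1) := by
    intro n
    have e1 : φ (star b * h n * b) = inner ℂ (toPreGNS hφ b) (toPreGNS hφ (h n * b)) := by
      rw [preGNS_inner, mul_assoc]
    have e2 : q (n + 1) = ‖toPreGNS hφ (h n * b)‖ ^ 2 := by
      rw [preGNS_norm_sq]
      simp only [q, h_succ, star_mul, h_sa, mul_assoc]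
    have e3 : s = ‖toPreGNS hφ b‖ ^ 2 := (preGNS_norm_sq hφ b).symm
    have e4 : |q n| ≤ ‖toPreGNS hφ b‖ * ‖toPreGNS hφ (h n * b)‖ :=
      (Complex.abs_re_le_norm _).trans (e1 ▸ norm_inner_le_norm _ _)
    rw [e2, e3, ← mul_pow, ← sq_abs]
    gcongr
  obtain ⟨c, hc0, hcb⟩ : ∃ c : ℝ, 0 ≤ c ∧ ∀ x : A, star x = x → ‖φ (star b * x * b)‖ ≤ c * ‖x‖ := by
    have h0 := hc b 0 (IsSelfAdjoint.zero A)
    rw [Metric.continuousWithinAt_iff] at h0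
    obtain ⟨δ, hδ, hd⟩ := h0 1 one_pos
    refine ⟨2 / δ, by positivity, fun x hx => ?_⟩
    rcases eq_or_ne x 0 with rfl | hx0
    · simp
    have hxn : 0 < ‖x‖ := norm_pos_iff.mpr hx0
    set t : ℝ := δ / (2 * ‖x‖) with ht
    have ht0 : 0 < t := by positivity
    have hsa : IsSelfAdjoint ((t : ℂ) • x) := by
      change star ((t : ℂ) • x) = _
      rw [star_smul, hx, Complex.star_def, Complex.conj_ofReal]
    have hdist : dist ((t : ℂ) • x) 0 < δ := by
      rw [dist_zero_right, norm_smul, Complex.norm_real, Real.norm_of_nonneg ht0.le, ht]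
      field_simp
      linarith
    have := hd hsa hdist
    simp only [mul_smul_comm, smul_mul_assoc, map_smul, smul_eq_mul, mul_zero, zero_mul, map_zero,
      dist_zero_right, norm_mul, Complex.norm_real, Real.norm_of_nonneg ht0.le] at this
    rw [ht] at this
    have h3 : ‖φ (star b * x * b)‖ < (2 * ‖x‖) / δ := by
      rw [lt_div_iff₀ hδ]
      rw [div_mul_eq_mul_div, div_lt_one (by positivity)] at this
      linarith
    calc _ ≤ (2 * ‖x‖) / δ := h3.le
      _ = 2 / δ * ‖x‖ := by ring
  have q_le : ∀ n, q n ≤ c * ‖star a * a‖ ^ (2 ^ n) := fun n =>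
    ((Complex.re_le_norm _).trans (hcb _ (h_sa n))).trans
      (mul_le_mul_of_nonneg_left (h_norm n) hc0)
  have q0_nonneg : 0 ≤ q 0 := by rw [q_zero]; positivity
  have key : q 0 ≤ ‖star a * a‖ * s := by
    rcases hs0.eq_or_lt with hs1 | hs1
    · have := q_step 0
      rw [← hs1, zero_mul] at this
      rw [pow_eq_zero_iff two_ne_zero |>.mp (le_antisymm this (sq_nonneg _)), ← hs1, mul_zero]
    by_contra! hlt
    set r : ℝ := q 0 / s with hr
    have hr1 : ‖star a * a‖ < r := by rwa [hr, lt_div_iff₀ hs1]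
    have hr0 : 0 < r := lt_of_le_of_lt (norm_nonneg _) hr1
    have iter : ∀ n, r ^ (2 ^ n) ≤ q n / s := by
      intro n
      induction n with
      | zero => simp [hr]
      | succ n ih =>
        calc r ^ (2 ^ (n + 1)) = (r ^ (2 ^ n)) ^ 2 := by rw [← pow_mul]; congr 1
          _ ≤ (q n / s) ^ 2 := by gcongr
          _ = q n ^ 2 / s ^ 2 := by rw [div_pow]
          _ ≤ (s * q (n + 1)) / s ^ 2 := by gcongr; exact q_step n
          _ = q (n + 1) / s := by field_simp
    have hlim : Filter.Tendsto (fun n : ℕ => c / s * (‖star a * a‖ / r) ^ (2 ^ n)) Filter.atTop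
        (nhds 0) := by
      have h5 : Filter.Tendsto (fun n : ℕ => (‖star a * a‖ / r) ^ n) Filter.atTop (nhds 0) :=
        tendsto_pow_atTop_nhds_zero_of_lt_one (by positivity) ((div_lt_one hr0).mpr hr1)
      have h6 : Filter.Tendsto (fun n : ℕ => 2 ^ n) Filter.atTop Filter.atTop :=
        tendsto_pow_atTop_atTop_of_one_lt one_lt_two
      simpa using (h5.comp h6).const_mul (c / s)
    have hge : ∀ n : ℕ, 1 ≤ c / s * (‖star a * a‖ / r) ^ (2 ^ n) := by
      intro n
      have h7 := (iter n).trans (div_le_div_of_nonneg_right (q_le n) hs1.le)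
      rw [div_pow, ← mul_div_assoc, le_div_iff₀ (by positivity), one_mul]
      calc _ ≤ _ := h7
        _ = _ := by ring
    exact absurd (ge_of_tendsto' hlim hge) (by norm_num)
  rw [← sq_le_sq₀ (norm_nonneg _) (by positivity), mul_pow, Real.sq_sqrt (norm_nonneg _),
    ← q_zero, preGNS_norm_sq]
  exact key

/-- Left translation by `a`, as a bounded operator for the semi-inner product of `φ`. -/
def leftMul (hφ : IsPositive φ) (hc : IsWeaklyContinuousOnSA φ) (a : A) :
    PreGNS hφ →L[ℂ] PreGNS hφ :=
  ((toPreGNS hφ).toLinearMap ∘ₗ LinearMap.mulLeft ℂ a ∘ₗ (toPreGNS hφ).symm.toLinearMap).mkContinuous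
    (Real.sqrt ‖star a * a‖) fun x => preGNS_norm_mul_le hφ hc a ((toPreGNS hφ).symm x)

theorem leftMul_apply (hφ : IsPositive φ) (hc : IsWeaklyContinuousOnSA φ) (a b : A) :
    leftMul hφ hc a (toPreGNS hφ b) = toPreGNS hφ (a * b) := rfl

theorem leftMul_add (hφ : IsPositive φ) (hc : IsWeaklyContinuousOnSA φ) (a b : A)
    (x : PreGNS hφ) : leftMul hφ hc (a + b) x = leftMul hφ hc a x + leftMul hφ hc b x :=
  add_mul a b ((toPreGNS hφ).symm x)

theorem leftMul_smul (hφ : IsPositive φ) (hc : IsWeaklyContinuousOnSA φ) (m : ℂ) (a : A)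
    (x : PreGNS hφ) : leftMul hφ hc (m • a) x = m • leftMul hφ hc a x :=
  smul_mul_assoc m a ((toPreGNS hφ).symm x)

theorem leftMul_mul (hφ : IsPositive φ) (hc : IsWeaklyContinuousOnSA φ) (a b : A)
    (x : PreGNS hφ) : leftMul hφ hc (a * b) x = leftMul hφ hc a (leftMul hφ hc b x) :=
  mul_assoc a b ((toPreGNS hφ).symm x)

theorem leftMul_inner (hφ : IsPositive φ) (hc : IsWeaklyContinuousOnSA φ) (a : A)
    (x y : PreGNS hφ) : inner ℂ (leftMul hφ hc (star a) x) y = inner ℂ x (leftMul hφ hc a y) := by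
  change φ (star (star a * (toPreGNS hφ).symm x) * (toPreGNS hφ).symm y) =
    φ (star ((toPreGNS hφ).symm x) * (a * (toPreGNS hφ).symm y))
  rw [star_mul, star_star, mul_assoc]

theorem leftMul_completion_smul (hφ : IsPositive φ) (hc : IsWeaklyContinuousOnSA φ) (m : ℂ)
    (a : A) : (leftMul hφ hc (m • a)).completion = m • (leftMul hφ hc a).completion := by
  ext c
  induction c using UniformSpace.Completion.induction_on with
  | hp =>
    exact isClosed_eq (leftMul hφ hc (m • a)).completion.continuous
      (m • (leftMul hφ hc a).completion).continuous
  | ih c => simp [leftMul_smul]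

/-- The GNS representation `π_φ` of `A` in `H_φ`, for a positive linear functional `φ` that is
weakly continuous on `A_sa`: `π_φ(a)` is the continuous extension of left translation by `a`. -/
def gnsRep (hφ : IsPositive φ) (hc : IsWeaklyContinuousOnSA φ) :
    A →⋆ₙₐ[ℂ] (GNSSpace hφ →L[ℂ] GNSSpace hφ) where
  toFun a := (leftMul hφ hc a).completion
  map_smul' := leftMul_completion_smul hφ hc
  map_zero' := by simpa using leftMul_completion_smul hφ hc 0 0
  map_add' a b := by
    ext c
    induction c using UniformSpace.Completion.induction_on with
    | hp => apply isClosed_eq <;> fun_prop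
    | ih c => simp [leftMul_add, UniformSpace.Completion.coe_add]
  map_mul' a b := by
    ext c
    induction c using UniformSpace.Completion.induction_on with
    | hp => apply isClosed_eq <;> fun_prop
    | ih c => simp [leftMul_mul]
  map_star' a := by
    refine (ContinuousLinearMap.eq_adjoint_iff (leftMul hφ hc (star a)).completion
      (leftMul hφ hc a).completion).mpr ?_
    intro x y
    induction x, y using UniformSpace.Completion.induction_on₂ with
    | hp => apply isClosed_eq <;> fun_prop
    | ih x y => simp [leftMul_inner]

/-- The GNS representation `π_ψ` of a state `ψ`. -/
def IsState.gns {ψ : A →ₗ[ℂ] ℂ} (hψ : IsState ψ) :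
    A →⋆ₙₐ[ℂ] (GNSSpace hψ.positive →L[ℂ] GNSSpace hψ.positive) :=
  gnsRep hψ.positive hψ.weaklyContinuous

end GNS

end NormedStarAlg

end

/-! A state `ψ` has a cyclic vector `c` in `H_ψ` with `ψ(a) = ⟨π_ψ(a)c, c⟩`: finite variation
says exactly that `ψ` is bounded for the seminorm of its own form, and `c` is its Riesz vector. So
everything is about vector functionals `ω_c` of cyclic vectors, which determine the representation
up to spatial equivalence.

If `φ` is subordinate to `ω_c`, the Riesz vector `d` of `φ` satisfies `‖π(a)d‖ ≤ r‖π(a)c‖`, so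
`π(a)c ↦ π(a)d` extends to a bounded operator commuting with `π`. When `π` is irreducible this is a
scalar by Schur's lemma, and `ω_c` is indecomposable. An indecomposable state is pure because each
term of a convex decomposition is subordinate to it. For a closed invariant subspace `M` with
projection `P`, `ω_c = ω_{Pc} + ω_{(1-P)c}`, where the terms have variations `‖Pc‖²` and
`‖(1-P)c‖²` of sum `1`; purity makes `ω_{Pc}` a multiple of `ω_c`, so `P` is a scalar and `M` is
trivial.

The GNS bound `‖π_ψ(a)‖ ≤ ‖a*a‖^{1/2}` gives `‖π_ψ(a)‖ ≤ ‖a‖` on Hermitian elements, and applying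
this to the powers of `a*a`, with `‖T^n‖ = ‖T‖^n` for self-adjoint `T`, improves it to
σ-contractivity. -/

namespace NormedStarAlg

section DenseRange

variable {𝕜 E H : Type*} [RCLike 𝕜] [NormedAddCommGroup H] [InnerProductSpace 𝕜 H]

theorem exists_eq_inner_of_norm_le [CompleteSpace H] [AddCommGroup E] [Module 𝕜 E]
    {e : E →ₗ[𝕜] H} (he : DenseRange e) {φ : E →ₗ[𝕜] 𝕜} {C : ℝ}
    (h : ∀ a, ‖φ a‖ ≤ C * ‖e a‖) : ∃ d : H, ∀ a, φ a = inner 𝕜 d (e a) :=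
  ⟨(InnerProductSpace.toDual 𝕜 H).symm (φ.extendOfNorm e), fun a => by
    rw [InnerProductSpace.toDual_symm_apply, LinearMap.extendOfNorm_eq he ⟨C, h⟩]⟩

theorem norm_le_of_norm_inner_le {e : E → H} (he : DenseRange e) {x : H} {C : ℝ} (hC : 0 ≤ C)
    (h : ∀ a, ‖inner 𝕜 x (e a)‖ ≤ C * ‖e a‖) : ‖x‖ ≤ C := by
  rw [← innerSL_apply_norm 𝕜 x]
  refine ContinuousLinearMap.opNorm_le_bound _ hC fun y => ?_
  induction y using he.induction_on with
  | hp => apply isClosed_le <;> fun_prop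
  | ih a => simpa using h a

end DenseRange

section StarProjection

theorem eq_bot_or_eq_top_of_starProjection_eq_smul {𝕜 E : Type*} [RCLike 𝕜]
    [NormedAddCommGroup E] [InnerProductSpace 𝕜 E] {M : Submodule 𝕜 E}
    [M.HasOrthogonalProjection] {z : 𝕜} (h : ∀ x, M.starProjection x = z • x) :
    M = ⊥ ∨ M = ⊤ := by
  rcases eq_or_ne z 0 with rfl | hz
  · refine .inl ((Submodule.eq_bot_iff M).mpr fun x hx => ?_)
    rw [← M.starProjection_eq_self_iff.mpr hx, h, zero_smul]
  · refine .inr (Submodule.eq_top_iff'.mpr fun x => ?_)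
    rw [← inv_smul_smul₀ hz x, ← h]
    exact M.smul_mem _ (M.starProjection_apply_mem x)

end StarProjection

section CStarAlgebra

theorem norm_le_norm_pow_rpow_of_isSelfAdjoint {B : Type*} [CStarAlgebra B] {b : B}
    (hb : IsSelfAdjoint b) (n : ℕ) : ‖b‖ ≤ ‖b ^ (n + 1)‖ ^ (1 / ((n : ℝ) + 1)) := by
  rcases subsingleton_or_nontrivial B with _ | _
  · rw [Subsingleton.elim b 0, norm_zero]
    positivity
  have h := spectrum.spectralRadius_le_pow_nnnorm_pow_one_div ℂ b n
  rw [hb.spectralRadius_eq_nnnorm, nnnorm_one, ENNReal.coe_one, ENNReal.one_rpow, mul_one,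
    ← ENNReal.coe_rpow_of_nonneg _ (by positivity), ENNReal.coe_le_coe] at h
  exact_mod_cast h

end CStarAlgebra

section Schur

variable {A : Type*} [NonUnitalNormedRing A] [NormedSpace ℂ A] [StarRing A]
  {H : Type*} [NormedAddCommGroup H] [InnerProductSpace ℂ H] [CompleteSpace H]
  {π : A →⋆ₙₐ[ℂ] (H →L[ℂ] H)} {S T : H →L[ℂ] H}

theorem IsIrreducible.ker_eq_bot_or_eq_zero (hπ : IsIrreducible π)
    (hT : ∀ a, Commute T (π a)) : T.ker = ⊥ ∨ T = 0 := by
  refine (hπ.2 T.ker T.isClosed_ker fun a x hx => ?_).imp_right fun h =>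
    ContinuousLinearMap.coe_injective (LinearMap.ker_eq_top.mp h)
  have hx : T x = 0 := hx
  change (T * π a) x = 0
  rw [(hT a).eq, mul_apply_eq_comp, hx, map_zero]

theorem IsIrreducible.eq_zero_or_eq_zero_of_mul_eq_zero (hπ : IsIrreducible π)
    (hS : ∀ a, Commute S (π a)) (hST : S * T = 0) : S = 0 ∨ T = 0 := by
  refine (hπ.ker_eq_bot_or_eq_zero hS).symm.imp_right fun h => ?_
  ext x
  exact LinearMap.ker_eq_bot'.mp h (T x) congr($hST x)

theorem IsIrreducible.nonneg_or_nonpos (hπ : IsIrreducible π) (hsa : IsSelfAdjoint T)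
    (hT : ∀ a, Commute T (π a)) : 0 ≤ T ∨ T ≤ 0 := by
  have hpos : ∀ a, Commute T⁺ (π a) := fun a => by
    rw [CFC.posPart_def]
    exact (hT a).cfcₙ_real _
  exact (hπ.eq_zero_or_eq_zero_of_mul_eq_zero hpos (CFC.posPart_mul_negPart T)).symm.imp
    (CFC.negPart_eq_zero_iff T hsa).mp (CFC.posPart_eq_zero_iff T hsa).mp

theorem IsIrreducible.subsingleton_spectrum (hπ : IsIrreducible π) (hsa : IsSelfAdjoint T)
    (hT : ∀ a, Commute T (π a)) : (spectrum ℝ T).Subsingleton := by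
  have hle : ∀ p ∈ spectrum ℝ T, ∀ q ∈ spectrum ℝ T, q ≤ p := by
    intro p hp q hq
    by_contra! hpq
    obtain ⟨m, hpm, hmq⟩ := exists_between hpq
    have hm : IsSelfAdjoint (T - algebraMap ℝ (H →L[ℂ] H) m) :=
      hsa.sub (.algebraMap _ (.all m))
    rcases hπ.nonneg_or_nonpos hm fun a => (hT a).sub_left (Algebra.commutes' m (π a)) with h | h
    · exact hpm.not_ge ((algebraMap_le_iff_le_spectrum hsa).mp (sub_nonneg.mp h) p hp)
    · exact hmq.not_ge ((le_algebraMap_iff_spectrum_le hsa).mp (sub_nonpos.mp h) q hq)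
  exact fun p hp q hq => le_antisymm (hle q hq p hp) (hle p hp q hq)

theorem IsIrreducible.exists_eq_real_smul_one (hπ : IsIrreducible π) (hsa : IsSelfAdjoint T)
    (hT : ∀ a, Commute T (π a)) : ∃ r : ℝ, T = r • 1 := by
  obtain ⟨r, hr⟩ : ∃ r, spectrum ℝ T ⊆ {r} := by
    obtain h | ⟨r, h⟩ := (hπ.subsingleton_spectrum hsa hT).eq_empty_or_singleton
    · exact ⟨0, h.trans_subset (Set.empty_subset _)⟩
    · exact ⟨r, h.subset⟩
  refine ⟨r, ?_⟩
  rw [← Algebra.algebraMap_eq_smul_one]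
  exact CFC.eq_algebraMap_of_spectrum_subset_singleton T r hr hsa

theorem IsIrreducible.exists_eq_smul_one (hπ : IsIrreducible π)
    (hT : ∀ a, Commute T (π a)) : ∃ z : ℂ, T = z • 1 := by
  have hT' : ∀ a, Commute (star T) (π a) := fun a => by
    have h := (hT (star a)).star_star
    rwa [map_star, star_star] at h
  obtain ⟨r, hr⟩ := hπ.exists_eq_real_smul_one (realPart T).2 fun a => by
    rw [realPart_apply_coe]
    exact ((hT a).add_left (hT' a)).smul_left _
  obtain ⟨s, hs⟩ := hπ.exists_eq_real_smul_one (imaginaryPart T).2 fun a => by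
    rw [imaginaryPart_apply_coe]
    exact (((hT a).sub_left (hT' a)).smul_left _).smul_left _
  refine ⟨r + Complex.I * s, ?_⟩
  conv_lhs => rw [← realPart_add_I_smul_imaginaryPart T, hr, hs]
  rw [add_smul, mul_smul, Complex.coe_smul, Complex.coe_smul]

end Schur

section SigmaContractive

variable {A : Type*} [NonUnitalNormedRing A]

theorem map_powSucc {B F : Type*} [Monoid B] [FunLike F A B] [MulHomClass F A B] (f : F) (a : A)
    (n : ℕ) : f (powSucc a n) = f a ^ (n + 1) := by
  induction n with
  | zero => simp [powSucc]
  | succ n ih => rw [powSucc, map_mul, ih, ← pow_succ]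

theorem isSelfAdjoint_powSucc [StarRing A] {a : A} (ha : IsSelfAdjoint a) (n : ℕ) :
    IsSelfAdjoint (powSucc a n) := by
  have hcomm (m : ℕ) : Commute (powSucc a m) a := by
    induction m with
    | zero => exact Commute.refl a
    | succ m ih => exact ih.mul_left (Commute.refl a)
  induction n with
  | zero => exact ha
  | succ n ih => exact (ih.commute_iff ha).mp (hcomm n)

theorem rLambda_le_norm (a : A) : rLambda a ≤ ‖a‖ := by
  have hbdd : BddBelow (Set.range fun n : ℕ => ‖powSucc a n‖ ^ (1 / ((n : ℝ) + 1))) :=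
    ⟨0, by rintro _ ⟨n, rfl⟩; positivity⟩
  exact (ciInf_le hbdd 0).trans_eq (by simp [powSucc])

theorem rSigma_le_norm_of_isSelfAdjoint [StarRing A] {a : A} (ha : IsSelfAdjoint a) :
    rSigma a ≤ ‖a‖ := by
  refine Real.sqrt_le_iff.mpr ⟨norm_nonneg a, ?_⟩
  rw [ha.star_eq, sq]
  exact (rLambda_le_norm _).trans (norm_mul_le a a)

variable [NormedSpace ℂ A] [StarRing A]

section CStarAlgebra

variable {B : Type*} [CStarAlgebra B] {f : A →⋆ₙₐ[ℂ] B}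

theorem norm_map_le_rLambda_of_isSelfAdjoint (hf : ∀ a, IsSelfAdjoint a → ‖f a‖ ≤ ‖a‖) {a : A}
    (ha : IsSelfAdjoint a) : ‖f a‖ ≤ rLambda a := by
  refine le_ciInf fun n => (norm_le_norm_pow_rpow_of_isSelfAdjoint (ha.map f) n).trans ?_
  rw [← map_powSucc]
  gcongr
  exact hf _ (isSelfAdjoint_powSucc ha n)

theorem norm_map_le_rSigma (hf : ∀ a, IsSelfAdjoint a → ‖f a‖ ≤ ‖a‖) (a : A) :
    ‖f a‖ ≤ rSigma a := by
  refine Real.le_sqrt_of_sq_le ?_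
  rw [sq, ← CStarRing.norm_star_mul_self, ← map_star, ← map_mul]
  exact norm_map_le_rLambda_of_isSelfAdjoint hf (.star_mul_self a)

end CStarAlgebra

variable {H : Type*} [NormedAddCommGroup H] [InnerProductSpace ℂ H] [CompleteSpace H]
  {π : A →⋆ₙₐ[ℂ] (H →L[ℂ] H)}

theorem isSigmaContractive_iff_norm_le_of_isSelfAdjoint :
    IsSigmaContractive π ↔ ∀ a, IsSelfAdjoint a → ‖π a‖ ≤ ‖a‖ :=
  ⟨fun h a ha => (h a).trans (rSigma_le_norm_of_isSelfAdjoint ha), norm_map_le_rSigma⟩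

theorem IsSigmaContractive.continuousOn_isSelfAdjoint (hπ : IsSigmaContractive π) :
    ContinuousOn π {a | IsSelfAdjoint a} := by
  refine (LipschitzOnWith.of_dist_le_mul (K := 1) fun a ha b hb => ?_).continuousOn
  rw [NNReal.coe_one, one_mul, dist_eq_norm, dist_eq_norm, ← map_sub]
  exact isSigmaContractive_iff_norm_le_of_isSelfAdjoint.mp hπ _ (IsSelfAdjoint.sub ha hb)

end SigmaContractive

section Orbit

variable {A : Type*} [NonUnitalNonAssocRing A] [Module ℂ A] [Star A]
  {H : Type*} [NormedAddCommGroup H] [InnerProductSpace ℂ H] [CompleteSpace H]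

/-- The linear map `a ↦ π a x` of `A` onto the orbit of the vector `x`. -/
noncomputable def orbitMap (π : A →⋆ₙₐ[ℂ] (H →L[ℂ] H)) (x : H) : A →ₗ[ℂ] H where
  toFun a := π a x
  map_add' a b := by simp
  map_smul' z a := by simp

/-- The vector functional `a ↦ ⟪x, π a x⟫`, which is `a ↦ ⟨π(a) x, x⟩` in the convention where
the form is linear in the first variable. -/
noncomputable def vectorFunctional (π : A →⋆ₙₐ[ℂ] (H →L[ℂ] H)) (x : H) : A →ₗ[ℂ] ℂ :=
  (innerSL ℂ x).toLinearMap ∘ₗ orbitMap π x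

/-- A vector is cyclic for a representation if its orbit is dense. -/
abbrev IsCyclicVector (π : A →⋆ₙₐ[ℂ] (H →L[ℂ] H)) (x : H) : Prop :=
  DenseRange (orbitMap π x)

theorem orbitMap_apply (π : A →⋆ₙₐ[ℂ] (H →L[ℂ] H)) (x : H) (a : A) : orbitMap π x a = π a x :=
  rfl

theorem vectorFunctional_apply (π : A →⋆ₙₐ[ℂ] (H →L[ℂ] H)) (x : H) (a : A) :
    vectorFunctional π x a = inner ℂ x (π a x) :=
  rfl

theorem apply_orbitMap (π : A →⋆ₙₐ[ℂ] (H →L[ℂ] H)) (a b : A) (x : H) :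
    π a (orbitMap π x b) = orbitMap π x (a * b) := by
  simp [orbitMap_apply]

theorem inner_apply_star_left (π : A →⋆ₙₐ[ℂ] (H →L[ℂ] H)) (a : A) (x y : H) :
    inner ℂ (π (star a) x) y = inner ℂ x (π a y) := by
  rw [map_star, ContinuousLinearMap.star_eq_adjoint, ContinuousLinearMap.adjoint_inner_left]

theorem inner_orbitMap (π : A →⋆ₙₐ[ℂ] (H →L[ℂ] H)) (a b : A) (x y : H) :
    inner ℂ (orbitMap π x a) (orbitMap π y b) = inner ℂ x (π (star a * b) y) := by
  rw [map_mul, map_star, mul_apply_eq_comp, ContinuousLinearMap.star_eq_adjoint,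
    ContinuousLinearMap.adjoint_inner_right, orbitMap_apply, orbitMap_apply]

theorem vectorFunctional_star_mul_self (π : A →⋆ₙₐ[ℂ] (H →L[ℂ] H)) (x : H) (a : A) :
    vectorFunctional π x (star a * a) = (‖orbitMap π x a‖ ^ 2 : ℝ) := by
  rw [vectorFunctional_apply, ← inner_orbitMap, inner_self_eq_norm_sq_to_K, Complex.ofReal_pow]
  rfl

variable {π : A →⋆ₙₐ[ℂ] (H →L[ℂ] H)} {c d : H}

theorem IsCyclicVector.exists_ne_zero (hc : IsCyclicVector π c) (hc0 : c ≠ 0) :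
    ∃ a, π a ≠ 0 := by
  by_contra! h
  refine hc0 (Dense.eq_of_inner_left ℂ hc ?_)
  rintro _ ⟨a, rfl⟩
  simp [orbitMap_apply, h a]

theorem IsCyclicVector.exists_commute_of_norm_le (hc : IsCyclicVector π c) {C : ℝ}
    (h : ∀ a, ‖orbitMap π d a‖ ≤ C * ‖orbitMap π c a‖) :
    ∃ T : H →L[ℂ] H, (∀ a, Commute T (π a)) ∧ ∀ a, T (orbitMap π c a) = orbitMap π d a := by
  have hT : ∀ a, (orbitMap π d).extendOfNorm (orbitMap π c) (orbitMap π c a) = orbitMap π d a :=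
    LinearMap.extendOfNorm_eq hc ⟨C, h⟩
  refine ⟨(orbitMap π d).extendOfNorm (orbitMap π c), fun a => ?_, hT⟩
  ext x
  simp only [mul_apply_eq_comp]
  induction x using hc.induction_on with
  | hp => apply isClosed_eq <;> fun_prop
  | ih b => rw [apply_orbitMap, hT, hT, apply_orbitMap]

end Orbit

section InvariantSubspace

variable {A : Type*} [NonUnitalNonAssocRing A] [Module ℂ A] [Star A]
  {H : Type*} [NormedAddCommGroup H] [InnerProductSpace ℂ H] [CompleteSpace H]
  {π : A →⋆ₙₐ[ℂ] (H →L[ℂ] H)} {M : Submodule ℂ H}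

theorem apply_mem_orthogonal (hM : ∀ a, ∀ x ∈ M, π a x ∈ M) (a : A) {x : H} (hx : x ∈ Mᗮ) :
    π a x ∈ Mᗮ := fun y hy => by
  rw [← inner_apply_star_left]
  exact hx _ (hM _ y hy)

variable [M.HasOrthogonalProjection]

theorem starProjection_apply_comm (hM : ∀ a, ∀ x ∈ M, π a x ∈ M) (a : A) (x : H) :
    M.starProjection (π a x) = π a (M.starProjection x) := by
  refine Submodule.eq_starProjection_of_mem_orthogonal (hM a _ (M.starProjection_apply_mem x)) ?_
  rw [← map_sub]
  exact apply_mem_orthogonal hM a (M.sub_starProjection_mem_orthogonal x)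

theorem vectorFunctional_starProjection_apply (hM : ∀ a, ∀ x ∈ M, π a x ∈ M) (a : A) (x : H) :
    vectorFunctional π (M.starProjection x) a = inner ℂ x (π a (M.starProjection x)) := by
  rw [vectorFunctional_apply, Submodule.inner_starProjection_left_eq_right,
    starProjection_apply_comm hM, M.starProjection_eq_self_iff.mpr (M.starProjection_apply_mem x)]

theorem vectorFunctional_starProjection_add_orthogonal (hM : ∀ a, ∀ x ∈ M, π a x ∈ M) (x : H) :
    vectorFunctional π (M.starProjection x) + vectorFunctional π (Mᗮ.starProjection x) =
      vectorFunctional π x := by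
  ext a
  rw [LinearMap.add_apply, vectorFunctional_starProjection_apply hM,
    vectorFunctional_starProjection_apply fun a _ => apply_mem_orthogonal hM a,
    ← inner_add_right, ← map_add, M.starProjection_add_starProjection_orthogonal,
    vectorFunctional_apply]

theorem eq_bot_or_eq_top_of_vectorFunctional_eq_smul {c : H} (hc : IsCyclicVector π c)
    (hM : ∀ a, ∀ x ∈ M, π a x ∈ M) {z : ℂ}
    (h : vectorFunctional π (M.starProjection c) = z • vectorFunctional π c) :
    M = ⊥ ∨ M = ⊤ := by
  refine eq_bot_or_eq_top_of_starProjection_eq_smul (z := z) fun x =>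
    Dense.eq_of_inner_right ℂ hc ?_
  rintro _ ⟨a, rfl⟩
  induction x using hc.induction_on with
  | hp => apply isClosed_eq <;> fun_prop
  | ih b =>
    calc inner ℂ (orbitMap π c a) (M.starProjection (orbitMap π c b))
        = vectorFunctional π (M.starProjection c) (star a * b) := by
          rw [vectorFunctional_starProjection_apply hM, ← inner_orbitMap, orbitMap_apply π c b,
            starProjection_apply_comm hM, orbitMap_apply π (M.starProjection c)]
      _ = inner ℂ (orbitMap π c a) (z • orbitMap π c b) := by
          rw [h, LinearMap.smul_apply, vectorFunctional_apply, ← inner_orbitMap, inner_smul_right,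
            smul_eq_mul]

end InvariantSubspace

section Irreducible

variable {A : Type*} [NonUnitalNormedRing A] [NormedSpace ℂ A] [StarRing A]
  {H : Type*} [NormedAddCommGroup H] [InnerProductSpace ℂ H] [CompleteSpace H]
  {K : Type*} [NormedAddCommGroup K] [InnerProductSpace ℂ K] [CompleteSpace K]
  {π : A →⋆ₙₐ[ℂ] (H →L[ℂ] H)} {ρ : A →⋆ₙₐ[ℂ] (K →L[ℂ] K)} {x : H} {y : K}

theorem IsIrreducible.nontrivial (hπ : IsIrreducible π) : Nontrivial H := by
  obtain ⟨a, ha⟩ := hπ.1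
  by_contra! h
  exact ha (Subsingleton.elim _ _)

theorem IsIrreducible.eq_zero_of_orbitMap_eq_zero (hπ : IsIrreducible π)
    (hx : ∀ a, orbitMap π x a = 0) : x = 0 := by
  have hcl : IsClosed ((⨅ a, (π a).ker : Submodule ℂ H) : Set H) := by
    rw [Submodule.coe_iInf]
    exact isClosed_iInter fun a => (π a).isClosed_ker
  have hinv : ∀ b, ∀ y ∈ ⨅ a, (π a).ker, π b y ∈ ⨅ a, (π a).ker := by
    simp only [Submodule.mem_iInf]
    intro b y hy a
    exact (apply_orbitMap π a b y).trans (hy (a * b))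
  obtain h | h := hπ.2 _ hcl hinv
  · exact (Submodule.mem_bot ℂ).mp (h ▸ (Submodule.mem_iInf _).mpr hx)
  · obtain ⟨b, hb⟩ := hπ.1
    refine absurd (ContinuousLinearMap.ext fun y => ?_) hb
    exact (Submodule.mem_iInf _).mp (h ▸ Submodule.mem_top : y ∈ ⨅ a, (π a).ker) b

theorem IsIrreducible.isCyclicVector (hπ : IsIrreducible π) (hx : x ≠ 0) :
    IsCyclicVector π x := by
  have hinv : ∀ a, ∀ y ∈ (LinearMap.range (orbitMap π x)).topologicalClosure,
      π a y ∈ (LinearMap.range (orbitMap π x)).topologicalClosure := by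
    intro a y hy
    refine map_mem_closure (π a).continuous hy ?_
    rintro _ ⟨b, rfl⟩
    exact ⟨a * b, (apply_orbitMap π a b x).symm⟩
  obtain h | h := hπ.2 _ (Submodule.isClosed_topologicalClosure _) hinv
  · refine absurd (hπ.eq_zero_of_orbitMap_eq_zero fun a => ?_) hx
    exact (Submodule.mem_bot ℂ).mp (h ▸ Submodule.le_topologicalClosure _ ⟨a, rfl⟩)
  · exact Submodule.dense_iff_topologicalClosure_eq_top.mpr h

theorem IsIrreducible.exists_eq_smul_of_norm_le (hπ : IsIrreducible π) {c d : H}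
    (hc : IsCyclicVector π c) {C : ℝ} (h : ∀ a, ‖orbitMap π d a‖ ≤ C * ‖orbitMap π c a‖) :
    ∃ z : ℂ, d = z • c := by
  obtain ⟨T, hcomm, hT⟩ := hc.exists_commute_of_norm_le h
  obtain ⟨z, rfl⟩ := hπ.exists_eq_smul_one hcomm
  refine ⟨z, sub_eq_zero.mp (hπ.eq_zero_of_orbitMap_eq_zero fun a => ?_)⟩
  simpa [orbitMap_apply, sub_eq_zero] using (hT a).symm

theorem spatiallyEquivalent_of_vectorFunctional_eq (hx : IsCyclicVector π x)
    (hy : IsCyclicVector ρ y) (h : vectorFunctional π x = vectorFunctional ρ y) :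
    SpatiallyEquivalent π ρ := by
  have hnorm (a : A) : ‖orbitMap ρ y (LinearEquiv.refl ℂ A a)‖ = ‖orbitMap π x a‖ := by
    rw [LinearEquiv.refl_apply, ← sq_eq_sq₀ (norm_nonneg _) (norm_nonneg _), ← Complex.ofReal_inj,
      ← vectorFunctional_star_mul_self, ← vectorFunctional_star_mul_self, h]
  refine ⟨(LinearEquiv.refl ℂ A).extendOfIsometry _ _ hx hy hnorm, fun a v => ?_⟩
  induction v using hx.induction_on with
  | hp => apply isClosed_eq <;> fun_prop
  | ih b =>
    rw [apply_orbitMap, LinearEquiv.extendOfIsometry_eq, LinearEquiv.extendOfIsometry_eq,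
      LinearEquiv.refl_apply, LinearEquiv.refl_apply, apply_orbitMap]

end Irreducible

section Functionals

variable {A : Type*} [NonUnitalNormedRing A] [NormedSpace ℂ A] [StarRing A]
  {φ φ₁ φ₂ ψ : A →ₗ[ℂ] ℂ} {r : ℝ}

theorem IsPositive.re_nonneg (hφ : IsPositive φ) (a : A) : 0 ≤ (φ (star a * a)).re :=
  (Complex.le_def.mp (hφ a)).1

theorem IsPositive.smul (hφ : IsPositive φ) (hr : 0 ≤ r) : IsPositive (r • φ) := fun a =>
  smul_nonneg hr (hφ a)

theorem IsHermitian.smul (hφ : IsHermitian φ) (r : ℝ) : IsHermitian (r • φ) := fun a => by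
  simp [hφ a]

theorem IsWeaklyContinuousOnSA.smul (hφ : IsWeaklyContinuousOnSA φ) (r : ℝ) :
    IsWeaklyContinuousOnSA (r • φ) := fun b =>
  (hφ b).const_smul r

theorem IsPositive.isSubordinate_add (h : IsPositive φ₂) : IsSubordinate φ₁ (φ₁ + φ₂) :=
  ⟨1, zero_le_one, by rwa [Complex.ofReal_one, one_smul, add_sub_cancel_left]⟩

theorem IsSubordinate.exists_re_le (h : IsSubordinate φ₁ φ₂) :
    ∃ r : ℝ, 0 ≤ r ∧ ∀ a, (φ₁ (star a * a)).re ≤ r * (φ₂ (star a * a)).re := by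
  obtain ⟨r, hr, hpos⟩ := h
  refine ⟨r, hr, fun a => ?_⟩
  have := hpos.re_nonneg a
  rwa [LinearMap.sub_apply, LinearMap.smul_apply, smul_eq_mul, Complex.sub_re,
    Complex.re_ofReal_mul, sub_nonneg] at this

theorem bddBelow_variationBounds (φ : A →ₗ[ℂ] ℂ) : BddBelow (variationBounds φ) :=
  ⟨0, fun _ hv => hv.1⟩

theorem variation_mem_variationBounds (hfin : HasFiniteVariation φ) :
    variation φ ∈ variationBounds φ := by
  have hclosed : IsClosed (variationBounds φ) := by
    simp only [variationBounds, Set.ofPred_and, Set.ofPred_forall]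
    exact isClosed_Ici.inter (isClosed_iInter fun a => isClosed_le (by fun_prop) (by fun_prop))
  exact hclosed.csInf_mem hfin (bddBelow_variationBounds φ)

open scoped Pointwise in
theorem variationBounds_smul (hr : 0 < r) (φ : A →ₗ[ℂ] ℂ) :
    variationBounds (r • φ) = r • variationBounds φ := by
  ext v
  rw [Set.mem_smul_set_iff_inv_smul_mem₀ hr.ne']
  refine and_congr (by simp [hr]) (forall_congr' fun a => ?_)
  rw [LinearMap.smul_apply, LinearMap.smul_apply, norm_smul, Real.norm_of_nonneg hr.le, mul_pow,
    Complex.smul_re, smul_eq_mul, smul_eq_mul, inv_mul_eq_div, div_mul_eq_mul_div,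
    le_div_iff₀ hr]
  constructor <;> intro h <;> nlinarith

theorem variation_zero : variation (0 : A →ₗ[ℂ] ℂ) = 0 :=
  le_antisymm (csInf_le (bddBelow_variationBounds 0) ⟨le_rfl, fun a => by simp⟩)
    (Real.sInf_nonneg fun _ hv => hv.1)

theorem variation_smul (hr : 0 ≤ r) (φ : A →ₗ[ℂ] ℂ) : variation (r • φ) = r * variation φ := by
  obtain rfl | hr := hr.eq_or_lt
  · rw [zero_smul, zero_mul, variation_zero]
  · rw [variation, variationBounds_smul hr, Real.sInf_smul_of_nonneg hr.le, smul_eq_mul, variation]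

theorem HasFiniteVariation.smul (hfin : HasFiniteVariation φ) (hr : 0 < r) :
    HasFiniteVariation (r • φ) := by
  rw [HasFiniteVariation, variationBounds_smul hr]
  exact hfin.smul_set

theorem eq_zero_of_variation_eq_zero (hfin : HasFiniteVariation φ) (h : variation φ = 0) :
    φ = 0 := by
  ext a
  have ha := (variation_mem_variationBounds hfin).2 a
  rw [h, zero_mul] at ha
  simpa using ha.antisymm (sq_nonneg _)

theorem HasFiniteVariation.eq_zero_of_star_mul_self (hfin : HasFiniteVariation φ)
    (h : ∀ a, φ (star a * a) = 0) : φ = 0 := by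
  obtain ⟨v, hv⟩ := hfin
  ext a
  have ha := hv.2 a
  rw [h, Complex.zero_re, mul_zero] at ha
  simpa using ha.antisymm (sq_nonneg _)

theorem HasFiniteVariation.exists_eq_inner {H : Type*} [NormedAddCommGroup H]
    [InnerProductSpace ℂ H] [CompleteSpace H] (hfin : HasFiniteVariation φ) {e : A →ₗ[ℂ] H}
    (he : DenseRange e) (h : ∀ a, (φ (star a * a)).re ≤ r * ‖e a‖ ^ 2) :
    ∃ d : H, ∀ a, φ a = inner ℂ d (e a) := by
  obtain ⟨v, hv⟩ := hfin
  refine exists_eq_inner_of_norm_le (C := √v * √r) he fun a => ?_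
  calc ‖φ a‖ ≤ √(v * (φ (star a * a)).re) := Real.le_sqrt_of_sq_le (hv.2 a)
    _ ≤ √(v * (r * ‖e a‖ ^ 2)) := by gcongr; exacts [hv.1, h a]
    _ = √v * √r * ‖e a‖ := by
      rw [Real.sqrt_mul hv.1, Real.sqrt_mul' _ (sq_nonneg _), Real.sqrt_sq (norm_nonneg _),
        mul_assoc]

theorem exists_nonneg_smul_eq_of_isPositive_smul (hφ : IsPositive φ) (hfin : HasFiniteVariation φ)
    {z : ℂ} (hz : IsPositive (z • φ)) : ∃ r : ℝ, 0 ≤ r ∧ z • φ = r • φ := by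
  by_cases h : ∀ a, φ (star a * a) = 0
  · exact ⟨0, le_rfl, by rw [hfin.eq_zero_of_star_mul_self h, smul_zero, smul_zero]⟩
  push Not at h
  obtain ⟨a, ha⟩ := h
  have hz0 : 0 ≤ z := by
    have := mul_nonneg (hz a) (inv_nonneg.mpr (hφ a))
    rwa [LinearMap.smul_apply, smul_eq_mul, mul_inv_cancel_right₀ ha] at this
  refine ⟨z.re, (Complex.le_def.mp hz0).1, ?_⟩
  conv_lhs => rw [Complex.eq_re_of_ofReal_le hz0, Complex.coe_smul]

theorem IsState.eq_of_eq_smul (hψ : IsState ψ) (hφ : IsState φ) {z : ℂ} (h : φ = z • ψ) :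
    φ = ψ := by
  obtain ⟨r, hr, hz⟩ := exists_nonneg_smul_eq_of_isPositive_smul hψ.positive hψ.finiteVariation
    (h ▸ hφ.positive)
  rw [hz] at h
  have hr1 : r = 1 := by
    have := variation_smul hr ψ
    rwa [← h, hφ.variation_eq_one, hψ.variation_eq_one, mul_one, eq_comm] at this
  rw [h, hr1, one_smul]

theorem isState_inv_variation_smul (hφ : IsPositive φ) (hc : IsWeaklyContinuousOnSA φ)
    (hfin : HasFiniteVariation φ) (h : 0 < variation φ) : IsState ((variation φ)⁻¹ • φ) where
  positive := hφ.smul (inv_nonneg.mpr h.le)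
  weaklyContinuous := hc.smul _
  finiteVariation := hfin.smul (inv_pos.mpr h)
  variation_eq_one := by rw [variation_smul (inv_nonneg.mpr h.le), inv_mul_cancel₀ h.ne']

end Functionals

section States

variable {A : Type*} [NonUnitalNormedRing A] [NormedSpace ℂ A] [IsScalarTower ℂ A A]
  [SMulCommClass ℂ A A] [StarRing A] [StarModule ℂ A] {φ φ₁ φ₂ : A →ₗ[ℂ] ℂ}

theorem IsPositive.norm_star_mul_sq_le (hφ : IsPositive φ) (a b : A) :
    ‖φ (star a * b)‖ ^ 2 ≤ (φ (star a * a)).re * (φ (star b * b)).re := by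
  rw [← preGNS_norm_sq hφ, ← preGNS_norm_sq hφ, ← preGNS_inner hφ, ← mul_pow]
  gcongr
  exact norm_inner_le_norm _ _

theorem IsPureState.eq_variation_smul_of_add (h : IsPureState (φ₁ + φ₂)) (hφ₁ : IsPositive φ₁)
    (hφ₂ : IsPositive φ₂) (hc₁ : IsWeaklyContinuousOnSA φ₁) (hc₂ : IsWeaklyContinuousOnSA φ₂)
    (hfin₁ : HasFiniteVariation φ₁) (hfin₂ : HasFiniteVariation φ₂)
    (hadd : variation φ₁ + variation φ₂ = 1) : φ₁ = variation φ₁ • (φ₁ + φ₂) := by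
  obtain h₁ | h₁ := (variation_mem_variationBounds hfin₁).1.eq_or_lt
  · rw [← h₁, zero_smul, eq_zero_of_variation_eq_zero hfin₁ h₁.symm]
  obtain h₂ | h₂ := (variation_mem_variationBounds hfin₂).1.eq_or_lt
  · rw [← h₂, add_zero] at hadd
    rw [hadd, one_smul, eq_zero_of_variation_eq_zero hfin₂ h₂.symm, add_zero]
  rw [← (mem_extremePoints_iff_left.mp h).2 _ (isState_inv_variation_smul hφ₁ hc₁ hfin₁ h₁) _
    (isState_inv_variation_smul hφ₂ hc₂ hfin₂ h₂) ⟨_, _, h₁, h₂, hadd, by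
      rw [smul_inv_smul₀ h₁.ne', smul_inv_smul₀ h₂.ne']⟩, smul_inv_smul₀ h₁.ne']

end States

section VectorFunctional

variable {A : Type*} [NonUnitalNormedRing A] [NormedSpace ℂ A] [StarRing A]
  {H : Type*} [NormedAddCommGroup H] [InnerProductSpace ℂ H] [CompleteSpace H]
  {π : A →⋆ₙₐ[ℂ] (H →L[ℂ] H)} {x : H}

theorem isPositive_vectorFunctional (π : A →⋆ₙₐ[ℂ] (H →L[ℂ] H)) (x : H) :
    IsPositive (vectorFunctional π x) := fun a => by
  rw [vectorFunctional_star_mul_self, Complex.zero_le_real]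
  positivity

theorem isHermitian_vectorFunctional (π : A →⋆ₙₐ[ℂ] (H →L[ℂ] H)) (x : H) :
    IsHermitian (vectorFunctional π x) := fun a => by
  rw [vectorFunctional_apply, vectorFunctional_apply, ← inner_apply_star_left, star_star]
  exact (inner_conj_symm _ _).symm

theorem norm_sq_mem_variationBounds (π : A →⋆ₙₐ[ℂ] (H →L[ℂ] H)) (x : H) :
    ‖x‖ ^ 2 ∈ variationBounds (vectorFunctional π x) := by
  refine ⟨by positivity, fun a => ?_⟩
  rw [vectorFunctional_star_mul_self, Complex.ofReal_re, ← mul_pow]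
  gcongr
  exact norm_inner_le_norm _ _

theorem hasFiniteVariation_vectorFunctional (π : A →⋆ₙₐ[ℂ] (H →L[ℂ] H)) (x : H) :
    HasFiniteVariation (vectorFunctional π x) :=
  ⟨_, norm_sq_mem_variationBounds π x⟩

theorem isWeaklyContinuousOnSA_vectorFunctional (hπ : ContinuousOn π {a | IsSelfAdjoint a})
    (x : H) : IsWeaklyContinuousOnSA (vectorFunctional π x) := fun b => by
  have h (a : A) : vectorFunctional π x (star b * a * b) =
      inner ℂ (orbitMap π x b) (π a (orbitMap π x b)) := by
    rw [vectorFunctional_apply, mul_assoc, ← inner_orbitMap, apply_orbitMap]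
  simp only [h]
  fun_prop

theorem mem_closure_range_orbitMap_of_commute {c : H} (hc : IsCyclicVector π c) {S : H →L[ℂ] H}
    (hS : ∀ a y, S (π a y) = π a (S y)) : S c ∈ closure (Set.range (orbitMap π (S c))) := by
  refine map_mem_closure S.continuous (hc c) ?_
  rintro _ ⟨a, rfl⟩
  exact ⟨a, (hS a c).symm⟩

theorem variation_vectorFunctional (hx : x ∈ closure (Set.range (orbitMap π x))) :
    variation (vectorFunctional π x) = ‖x‖ ^ 2 := by
  refine le_antisymm (csInf_le (bddBelow_variationBounds _) (norm_sq_mem_variationBounds π x))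
    (le_csInf (hasFiniteVariation_vectorFunctional π x) fun v hv => ?_)
  have hle (y : H) (hy : y ∈ closure (Set.range (orbitMap π x))) :
      ‖inner ℂ x y‖ ^ 2 ≤ v * ‖y‖ ^ 2 := by
    refine closure_minimal (t := {y | ‖inner ℂ x y‖ ^ 2 ≤ v * ‖y‖ ^ 2}) ?_
      (isClosed_le (by fun_prop) (by fun_prop)) hy
    rintro _ ⟨a, rfl⟩
    have ha := hv.2 a
    rwa [vectorFunctional_star_mul_self, Complex.ofReal_re] at ha
  obtain h | h := (sq_nonneg ‖x‖).eq_or_lt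
  · exact h.symm.trans_le hv.1
  · refine le_of_mul_le_mul_right ?_ h
    simpa [inner_self_eq_norm_sq_to_K, sq] using hle x hx

theorem isState_vectorFunctional (hπ : ContinuousOn π {a | IsSelfAdjoint a})
    (hx : x ∈ closure (Set.range (orbitMap π x))) (hx1 : ‖x‖ = 1) :
    IsState (vectorFunctional π x) where
  positive := isPositive_vectorFunctional π x
  weaklyContinuous := isWeaklyContinuousOnSA_vectorFunctional hπ x
  finiteVariation := hasFiniteVariation_vectorFunctional π x
  variation_eq_one := by rw [variation_vectorFunctional hx, hx1, one_pow]

end VectorFunctional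

section GNS

variable {A : Type*} [NonUnitalNormedRing A] [NormedSpace ℂ A] [IsScalarTower ℂ A A]
  [SMulCommClass ℂ A A] [StarRing A] [StarModule ℂ A] {φ ψ : A →ₗ[ℂ] ℂ}

/-- The canonical map of `A` onto a dense subspace of `H_φ`. -/
noncomputable def toGNS (hφ : IsPositive φ) : A →ₗ[ℂ] GNSSpace hφ :=
  (UniformSpace.Completion.toComplL (𝕜 := ℂ) (E := PreGNS hφ)).toLinearMap ∘ₗ
    (toPreGNS hφ).toLinearMap

theorem denseRange_toGNS (hφ : IsPositive φ) : DenseRange (toGNS hφ) :=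
  UniformSpace.Completion.denseRange_coe.comp (toPreGNS hφ).surjective.denseRange
    (UniformSpace.Completion.continuous_coe _)

theorem norm_toGNS (hφ : IsPositive φ) (a : A) : ‖toGNS hφ a‖ = ‖toPreGNS hφ a‖ :=
  UniformSpace.Completion.norm_coe _

theorem inner_toGNS (hφ : IsPositive φ) (a b : A) :
    inner ℂ (toGNS hφ a) (toGNS hφ b) = φ (star a * b) :=
  (UniformSpace.Completion.inner_coe _ _).trans (preGNS_inner hφ a b)

theorem gnsRep_apply_toGNS (hφ : IsPositive φ) (hc : IsWeaklyContinuousOnSA φ) (a b : A) :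
    gnsRep hφ hc a (toGNS hφ b) = toGNS hφ (a * b) :=
  (leftMul hφ hc a).completion_apply_coe _

theorem norm_gnsRep_le (hφ : IsPositive φ) (hc : IsWeaklyContinuousOnSA φ) (a : A) :
    ‖gnsRep hφ hc a‖ ≤ √‖star a * a‖ := by
  refine ContinuousLinearMap.opNorm_le_bound _ (Real.sqrt_nonneg _) fun y => ?_
  induction y using (denseRange_toGNS hφ).induction_on with
  | hp => apply isClosed_le <;> fun_prop
  | ih b =>
    rw [gnsRep_apply_toGNS, norm_toGNS, norm_toGNS]
    exact preGNS_norm_mul_le hφ hc a b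

theorem isSigmaContractive_gnsRep (hφ : IsPositive φ) (hc : IsWeaklyContinuousOnSA φ) :
    IsSigmaContractive (gnsRep hφ hc) :=
  isSigmaContractive_iff_norm_le_of_isSelfAdjoint.mpr fun a ha =>
    (norm_gnsRep_le hφ hc a).trans <| Real.sqrt_le_iff.mpr
      ⟨norm_nonneg a, by simpa only [ha.star_eq, sq] using norm_mul_le a a⟩

theorem exists_isCyclicVector_gnsRep (hφ : IsPositive φ) (hc : IsWeaklyContinuousOnSA φ)
    (hfin : HasFiniteVariation φ) :
    ∃ c, IsCyclicVector (gnsRep hφ hc) c ∧ vectorFunctional (gnsRep hφ hc) c = φ := by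
  obtain ⟨c, h⟩ := hfin.exists_eq_inner (r := 1) (denseRange_toGNS hφ) fun a => by
    rw [one_mul, norm_toGNS, preGNS_norm_sq]
  have horb : orbitMap (gnsRep hφ hc) c = toGNS hφ := by
    ext a
    refine Dense.eq_of_inner_left ℂ (denseRange_toGNS hφ) ?_
    rintro _ ⟨b, rfl⟩
    rw [inner_toGNS, h, ← gnsRep_apply_toGNS hφ hc, ← inner_apply_star_left, star_star,
      orbitMap_apply]
  refine ⟨c, by rw [IsCyclicVector, horb]; exact denseRange_toGNS hφ, ?_⟩
  ext a
  rw [h, ← horb, vectorFunctional_apply, orbitMap_apply]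

theorem IsState.isHermitian (hψ : IsState ψ) : IsHermitian ψ := by
  obtain ⟨c, -, h⟩ :=
    exists_isCyclicVector_gnsRep hψ.positive hψ.weaklyContinuous hψ.finiteVariation
  exact h ▸ isHermitian_vectorFunctional _ c

end GNS

section PureStates

variable {A : Type*} [NonUnitalNormedRing A] [NormedSpace ℂ A] [IsScalarTower ℂ A A]
  [SMulCommClass ℂ A A] [StarRing A] [StarModule ℂ A]
  {H : Type*} [NormedAddCommGroup H] [InnerProductSpace ℂ H] [CompleteSpace H]
  {π : A →⋆ₙₐ[ℂ] (H →L[ℂ] H)} {φ ψ : A →ₗ[ℂ] ℂ} {c d : H} {r : ℝ}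

theorem norm_orbitMap_le_of_eq_inner (hφ : IsPositive φ) (hc : IsCyclicVector π c) (hr : 0 ≤ r)
    (h : ∀ a, (φ (star a * a)).re ≤ r * ‖orbitMap π c a‖ ^ 2)
    (hd : ∀ a, φ a = inner ℂ d (orbitMap π c a)) (a : A) :
    ‖orbitMap π d a‖ ≤ r * ‖orbitMap π c a‖ := by
  refine norm_le_of_norm_inner_le (𝕜 := ℂ) hc (by positivity) fun b => ?_
  rw [inner_orbitMap, ← orbitMap_apply, ← hd, ← sq_le_sq₀ (norm_nonneg _) (by positivity)]
  calc ‖φ (star a * b)‖ ^ 2 ≤ (φ (star a * a)).re * (φ (star b * b)).re :=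
        hφ.norm_star_mul_sq_le a b
    _ ≤ (r * ‖orbitMap π c a‖ ^ 2) * (r * ‖orbitMap π c b‖ ^ 2) := by
        gcongr
        exacts [hφ.re_nonneg b, h a, h b]
    _ = (r * ‖orbitMap π c a‖ * ‖orbitMap π c b‖) ^ 2 := by ring

theorem IsIrreducible.exists_eq_smul_of_isSubordinate (hπ : IsIrreducible π)
    (hc : IsCyclicVector π c) (hφ : IsPositive φ) (hfin : HasFiniteVariation φ)
    (hsub : IsSubordinate φ (vectorFunctional π c)) : ∃ z : ℂ, φ = z • vectorFunctional π c := by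
  obtain ⟨r, hr, hle⟩ := hsub.exists_re_le
  simp only [vectorFunctional_star_mul_self, Complex.ofReal_re] at hle
  obtain ⟨d, hd⟩ := hfin.exists_eq_inner hc hle
  obtain ⟨z, rfl⟩ :=
    hπ.exists_eq_smul_of_norm_le hc (norm_orbitMap_le_of_eq_inner hφ hc hr hle hd)
  exact ⟨star z, LinearMap.ext fun a => (hd a).trans (inner_smul_left _ _ _)⟩

theorem IsIrreducible.isIndecomposable (hπ : IsIrreducible π) (hc : IsCyclicVector π c) :
    IsIndecomposable (vectorFunctional π c) where
  positive := isPositive_vectorFunctional π c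
  hermitian := isHermitian_vectorFunctional π c
  finiteVariation := hasFiniteVariation_vectorFunctional π c
  eq_smul _ hφ _ hfin hsub := hπ.exists_eq_smul_of_isSubordinate hc hφ hfin hsub

theorem IsIndecomposable.isPureState (h : IsIndecomposable ψ) (hψ : IsState ψ) :
    IsPureState ψ := by
  refine mem_extremePoints_iff_left.mpr ⟨hψ, ?_⟩
  rintro φ₁ (h₁ : IsState φ₁) φ₂ (h₂ : IsState φ₂) ⟨s, t, hs, ht, -, rfl⟩
  obtain ⟨z, hz⟩ := h.eq_smul (s • φ₁) (h₁.positive.smul hs.le) (h₁.isHermitian.smul s)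
    (h₁.finiteVariation.smul hs) (h₂.positive.smul ht.le).isSubordinate_add
  refine hψ.eq_of_eq_smul h₁ (z := s⁻¹ • z) ?_
  rw [smul_assoc, ← hz, inv_smul_smul₀ hs.ne']

theorem IsPureState.exists_vectorFunctional_starProjection_eq_smul
    (hπ : ContinuousOn π {a | IsSelfAdjoint a}) (hc : IsCyclicVector π c) (hc1 : ‖c‖ = 1)
    (h : IsPureState (vectorFunctional π c)) {M : Submodule ℂ H} [M.HasOrthogonalProjection]
    (hM : ∀ a, ∀ x ∈ M, π a x ∈ M) :
    ∃ z : ℂ, vectorFunctional π (M.starProjection c) = z • vectorFunctional π c := by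
  have hvar {N : Submodule ℂ H} [N.HasOrthogonalProjection] (hN : ∀ a, ∀ x ∈ N, π a x ∈ N) :
      variation (vectorFunctional π (N.starProjection c)) = ‖N.starProjection c‖ ^ 2 :=
    variation_vectorFunctional
      (mem_closure_range_orbitMap_of_commute hc (starProjection_apply_comm hN))
  have hadd := vectorFunctional_starProjection_add_orthogonal hM c
  rw [← hadd] at h ⊢
  refine ⟨variation (vectorFunctional π (M.starProjection c)), ?_⟩
  rw [Complex.coe_smul]
  refine h.eq_variation_smul_of_add (isPositive_vectorFunctional _ _)
    (isPositive_vectorFunctional _ _) (isWeaklyContinuousOnSA_vectorFunctional hπ _)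
    (isWeaklyContinuousOnSA_vectorFunctional hπ _) (hasFiniteVariation_vectorFunctional _ _)
    (hasFiniteVariation_vectorFunctional _ _) ?_
  rw [hvar hM, hvar fun a _ => apply_mem_orthogonal hM a,
    ← Submodule.norm_sq_eq_add_norm_sq_starProjection, hc1, one_pow]

theorem IsPureState.isIrreducible (hπ : ContinuousOn π {a | IsSelfAdjoint a})
    (hc : IsCyclicVector π c) (hc1 : ‖c‖ = 1) (h : IsPureState (vectorFunctional π c)) :
    IsIrreducible π := by
  refine ⟨hc.exists_ne_zero (norm_ne_zero_iff.mp (hc1.symm ▸ one_ne_zero)), fun M hcl hM => ?_⟩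
  have : CompleteSpace M := hcl.completeSpace_coe
  obtain ⟨z, hz⟩ := h.exists_vectorFunctional_starProjection_eq_smul hπ hc hc1 hM
  exact eq_bot_or_eq_top_of_vectorFunctional_eq_smul hc hM hz

theorem tfae_vectorFunctional (hπ : ContinuousOn π {a | IsSelfAdjoint a})
    (hc : IsCyclicVector π c) (hc1 : ‖c‖ = 1) :
    [IsIrreducible π, IsIndecomposable (vectorFunctional π c),
      IsPureState (vectorFunctional π c)].TFAE := by
  tfae_have 1 → 2 := fun h => h.isIndecomposable hc
  tfae_have 2 → 3 := fun h => h.isPureState (isState_vectorFunctional hπ (hc c) hc1)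
  tfae_have 3 → 1 := fun h => h.isIrreducible hπ hc hc1
  tfae_finish

theorem IsState.tfae (hψ : IsState ψ) :
    [IsIrreducible hψ.gns, IsIndecomposable ψ, IsPureState ψ].TFAE := by
  obtain ⟨c, hc, hcψ⟩ :=
    exists_isCyclicVector_gnsRep hψ.positive hψ.weaklyContinuous hψ.finiteVariation
  have hc1 : ‖c‖ = 1 := by
    have := variation_vectorFunctional (hc c)
    rw [hcψ, hψ.variation_eq_one, eq_comm] at this
    exact (pow_eq_one_iff_of_nonneg (norm_nonneg c) two_ne_zero).mp this
  have := tfae_vectorFunctional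
    (isSigmaContractive_gnsRep hψ.positive hψ.weaklyContinuous).continuousOn_isSelfAdjoint hc hc1
  rwa [hcψ] at this

theorem IsIrreducible.exists_isPureState (hπ : IsIrreducible π) (hσ : IsSigmaContractive π) :
    ∃ (ψ : A →ₗ[ℂ] ℂ) (hψ : IsPureState ψ), SpatiallyEquivalent π hψ.isState.gns := by
  have := hπ.nontrivial
  obtain ⟨c, hc1⟩ := exists_norm_eq H zero_le_one
  have hc : IsCyclicVector π c := hπ.isCyclicVector (norm_ne_zero_iff.mp (hc1.symm ▸ one_ne_zero))
  have hpure : IsPureState (vectorFunctional π c) :=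
    ((tfae_vectorFunctional hσ.continuousOn_isSelfAdjoint hc hc1).out 0 2).mp hπ
  obtain ⟨d, hd, hdc⟩ := exists_isCyclicVector_gnsRep hpure.isState.positive
    hpure.isState.weaklyContinuous hpure.isState.finiteVariation
  exact ⟨_, hpure, spatiallyEquivalent_of_vectorFunctional_eq hc hd hdc.symm⟩

end PureStates

end NormedStarAlg

theorem mainTheorem10 {A : Type*} [NonUnitalNormedRing A] [NormedSpace ℂ A]
    [IsScalarTower ℂ A A] [SMulCommClass ℂ A A] [StarRing A] [StarModule ℂ A] :
    (∀ (ψ : A →ₗ[ℂ] ℂ) (hψ : NormedStarAlg.IsState ψ),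
      [NormedStarAlg.IsIrreducible hψ.gns,
        NormedStarAlg.IsIndecomposable ψ,
        NormedStarAlg.IsPureState ψ].TFAE) ∧
    (∀ (ψ : A →ₗ[ℂ] ℂ) (hψ : NormedStarAlg.IsPureState ψ),
      NormedStarAlg.IsIrreducible hψ.isState.gns ∧
        NormedStarAlg.IsSigmaContractive hψ.isState.gns) ∧
    (∀ (H : Type*) [NormedAddCommGroup H] [InnerProductSpace ℂ H] [CompleteSpace H]
      (π : A →⋆ₙₐ[ℂ] (H →L[ℂ] H)),
      NormedStarAlg.IsIrreducible π → NormedStarAlg.IsSigmaContractive π →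
        ∃ (ψ : A →ₗ[ℂ] ℂ) (hψ : NormedStarAlg.IsPureState ψ),
          NormedStarAlg.SpatiallyEquivalent π hψ.isState.gns) :=
  ⟨fun _ hψ => hψ.tfae,
    fun _ hψ => ⟨(hψ.isState.tfae.out 2 0).mp hψ, NormedStarAlg.isSigmaContractive_gnsRep _ _⟩,
    fun _ _ _ _ _ hπ hσ => hπ.exists_isPureState hσ⟩
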